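/- **Setting.** Let $\mathbb E$ be a finite-dimensional Euclidean space, $m\ge 2$, $\lambda\in[0,1]$, and let $A_1,\dots,A_m\subseteq\mathbb E$; all indices are read modulo $m$, so $A_{m+1}=A_1$. For a set $A$ let $P_A(x)$ be the set of nearest points of $A$ to $x$, $R_A=2P_A-\mathrm{Id}$, and $$T_{i,j}=\tfrac{\lambda}{2}\,(R_{A_i}R_{A_j}+\mathrm{Id})+(1-\lambda)P_{A_j},\qquad T=T_{1,2}\circ T_{2,3}\circ\cdots\circ T_{m-1,m}\circ T_{m,1}$$ (set-valued mappings; $TS:=\bigcup_{x\in S}Tx$, sums are Minkowski sums of the values). Put $\mathrm{Fix}\,T=\{x: x\in Tx\}$. Let $U_1,\dots,U_m$ be open sets, $\Lambda_j:=P_{A_j}^{-1}(A_j\cap U_j)\cap U_j$, and $\epsilon_j\in[0,1)$. Assume: 1. there is a point $\bar y\in\mathrm{Fix}\,T\cap U_1$; 2. for every $j$: $A_j$ is nonempty and closed; $U_j$ contains a point of $A_j$; and $A_j$ is $\epsilon_j$-super-regular at a distance relative to $\Lambda_j$ on $U_j$, i.e. $$\langle v-(y'-y),\,y-x\rangle\le\epsilon_j\,\|v-(y'-y)\|\,\|y-x\|$$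 for all $y'\in U_j\cap\Lambda_j$, $y\in P_{A_j}(y')$ and all $x$, $v$ with $v$ in the proximal normal cone of $A_j$ at $x$, $x+v\in U_j$ and $x\in P_{A_j}(x+v)$; 3. for every $j$: $R_{A_{j+1}}U_{j+1}\subseteq U_j$, $R_{A_{j+1}}\Lambda_{j+1}\subseteq\Lambda_j$, $T_{j,j+1}\Lambda_{j+1}\subseteq\Lambda_j$, $T_{j,j+1}U_{j+1}\subseteq U_j$; 4. $\mathrm{dist}(x,\mathrm{Fix}\,T\cap\Lambda_1)\le\rho(\mathrm{dist}(x,Tx))$ for all $x\in U_1\cap\Lambda_1$, where $\rho:[0,\infty)\to[0,\infty)$ is a gauge (continuous, strictly increasing, $\rho(0)=0$, $\rho(t)\to\infty$ as $t\to\infty$), and the distance to the empty set is $\infty$; 5. for every $i$: $P_{A_{i+1}}\Lambda_{i+1}\subseteq\Lambda_i$ and $P_{A_{i+1}}U_{i+1}\subseteq U_i$. For a sequence $y^{(k+1)}\in Ty^{(k)}$, $k\ge0$, choose $y^{(m+1,k)}\in P_{A_{m+1}}y^{(k)}$ and $y^{(i,k)}\in P_{A_i}y^{(i+1,k)}$ for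 $i=m,\dots,1$, and set $\mathrm{gap}^{(k)}=\sum_{i=1}^m\|y^{(i+1,k)}-y^{(i,k)}\|$. Consider the claim > $(\ast)$ $\mathrm{gap}^{(k)}$ converges, as $k\to\infty$, to some $g\ge0$; and if $g=0$, then $\bigcap_{i=1}^mA_i\ne\emptyset$. **Corollary.** (i) Put $\tilde\epsilon_j=\frac{8\epsilon_j(1+\epsilon_j)}{(1-\epsilon_j)^2}$, $\epsilon_{j,j+1}=\frac12\big[(\lambda\sqrt{1+\tilde\epsilon_j}+1-\lambda)^2(1+\tilde\epsilon_{j+1})-1\big]$, $\epsilon=\prod_{j=1}^m(1+\epsilon_{j,j+1})-1$ and $\alpha=\frac m{m+1}$. Let $\theta$ be a gauge with $$\rho\left(\left(\frac{(1+\epsilon)t^2-\theta(t)^2}{(1-\alpha)/\alpha}\right)^{1/2}\right)=t\qquad(t\ge0),$$ and let $\bar t>0$ be such that $0<\theta(t)<t$ for $t\in(0,\bar t]$. Then there is $\delta>0$ such that $(\ast)$ holds for every such sequence, and every choice of the points $y^{(i,k)}$, with $y^{(0)}\in\Lambda_1$ and $\mathrm{dist}(y^{(0)},\mathrm{Fix}\,T\cap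 U_1)<\delta$, provided that one of the following holds ($\theta^{(k)}$ is the $k$-fold composition): - (a) $\theta^{(k)}(t)\to0$ as $k\to\infty$ for all $t\in(0,\bar t)$, and $\|y^{(k+1)}-z\|\le\|y^{(k)}-z\|$ for all $k$ and all $z\in\mathrm{Fix}\,T$; - (b) $\sum_{j\ge1}\theta^{(j)}(t)<\infty$ for all $t\in(0,\bar t)$. (ii) Suppose that $\rho(t)=\kappa t$ with some $\kappa>0$, and that for some $\bar\alpha\in(0,1)$ and every $\bar\epsilon\in(0,1)$ there is an open set $V\ni\bar y$ such that $$\|x^+-z^+\|^2\le(1+\bar\epsilon)\|x-z\|^2-\tfrac{1-\bar\alpha}{\bar\alpha}\|(x^+-x)-(z^+-z)\|^2$$ for all $z\in\mathrm{Fix}\,T\cap\Lambda_1\cap V$, $x\in V$, $x^+\in Tx$, $z^+\in Tz$. Then there is $\delta>0$ such that $(\ast)$ holds for every such sequence, and every choice of the points $y^{(i,k)}$, with $y^{(0)}\in\Lambda_1$ and $\|y^{(0)}-\bar y\|<\delta$. -/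

import Mathlib

open Filter Topology
open scoped NNReal ENNReal

namespace CDR

/-! Set-valued mappings from `E` to `E`. -/

/-- A set-valued mapping; `T x` is the set of values at `x`. -/
abbrev SetMap (E : Type*) := E → Set E

namespace SetMap

variable {E : Type*}

/-- Image of a set: the union of the values on it. -/
def image (T : SetMap E) (S : Set E) : Set E := ⋃ x ∈ S, T x

/-- Composition: `(T ∘ Q) x` is the union of `T y` over `y ∈ Q x`. -/
def comp (T Q : SetMap E) : SetMap E := fun x => T.image (Q x)

/-- Inverse mapping: the points whose value contains `a`. -/
def inv (T : SetMap E) : SetMap E := fun a => {x | a ∈ T x}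

/-- Fixed points: `x ∈ T x`. -/
def fix (T : SetMap E) : Set E := {x | x ∈ T x}

end SetMap

section Operators

variable {E : Type*} [NormedAddCommGroup E] [InnerProductSpace ℝ E]

/-- Metric projector: the set of nearest points of `A` to `x`. -/
def proj (A : Set E) : SetMap E := fun x => {a | a ∈ A ∧ ∀ b ∈ A, ‖a - x‖ ≤ ‖b - x‖}

/-- Reflector `2 P_A - Id`. -/
def refl (A : Set E) : SetMap E := fun x => {z | ∃ p ∈ proj A x, z = (2 : ℝ) • p - x}

/-- Relaxed Douglas-Rachford operator `(lam / 2) (R_A R_B + Id) + (1 - lam) P_B`, the sum of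
set-valued mappings being the Minkowski sum of the values. -/
def relaxedDR (lam : ℝ) (A B : Set E) : SetMap E := fun x =>
  {z | ∃ r ∈ (refl A).comp (refl B) x, ∃ p ∈ proj B x,
    z = (lam / 2) • (r + x) + (1 - lam) • p}

/-- `T_{1,2} ∘ T_{2,3} ∘ ⋯ ∘ T_{k,k+1}`, where `T_{i,j}` is the relaxed Douglas-Rachford operator
of `A_i` and `A_j`. The sets are indexed modulo `m`. -/
def partialCDR {m : ℕ} (lam : ℝ) (A : ZMod m → Set E) : ℕ → SetMap E
  | 0 => fun x => {x}
  | k + 1 => (partialCDR lam A k).comp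
      (relaxedDR lam (A ((k + 1 : ℕ) : ZMod m)) (A ((k + 2 : ℕ) : ZMod m)))

/-- The cyclic relaxed Douglas-Rachford operator `T_{1,2} ∘ ⋯ ∘ T_{m-1,m} ∘ T_{m,1}`. -/
def cyclicDR {m : ℕ} (lam : ℝ) (A : ZMod m → Set E) : SetMap E := partialCDR lam A m

/-- Proximal normal cone: the cone generated by `P_Ω⁻¹ a - a` (empty when `a ∉ Ω`). -/
def proxNormalCone (Ω : Set E) (a : E) : Set E :=
  {v | ∃ t : ℝ, 0 ≤ t ∧ ∃ z ∈ (proj Ω).inv a, v = t • (z - a)}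

/-- `Ω` is `eps`-super-regular at a distance relative to `L` at `xbar`, on the open
neighborhood `U` of `xbar`. -/
def IsSuperRegularAtDistance (Ω L U : Set E) (xbar : E) (eps : ℝ) : Prop :=
  IsOpen U ∧ xbar ∈ U ∧
    ∀ y' ∈ U ∩ L, ∀ y ∈ proj Ω y', ∀ x v : E,
      v ∈ proxNormalCone Ω x → x + v ∈ U → x ∈ proj Ω (x + v) →
        inner ℝ (v - (y' - y)) (y - x) ≤ eps * ‖v - (y' - y)‖ * ‖y - x‖

/-- The set `Λ = P_A⁻¹ (A ∩ U) ∩ U`. -/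
def lamSet (A U : Set E) : Set E := (proj A).inv.image (A ∩ U) ∩ U

/-- The inequality saying that `T` is pointwise almost `α`-firmly nonexpansive at `y` on `D`
with violation `eps`. -/
def IsPointwiseAFNE (T : SetMap E) (D : Set E) (y : E) (α eps : ℝ) : Prop :=
  ∀ x ∈ D, ∀ x' ∈ T x, ∀ y' ∈ T y,
    ‖x' - y'‖ ^ 2 ≤ (1 + eps) * ‖x - y‖ ^ 2 - (1 - α) / α * ‖(x' - x) - (y' - y)‖ ^ 2

/-- The standing assumption on the sets `A_j`, the neighborhoods `U_j` (each of some point of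
`A_j`) and the regularity constants `eps_j`, `j` being read modulo `m`. -/
structure StandingAssumption {m : ℕ} (lam : ℝ) (A U : ZMod m → Set E) (eps : ZMod m → ℝ) :
    Prop where
  nonempty : ∀ j, (A j).Nonempty
  isClosed : ∀ j, IsClosed (A j)
  eps_nonneg : ∀ j, 0 ≤ eps j
  eps_lt_one : ∀ j, eps j < 1
  superRegular : ∀ j, ∃ x ∈ A j,
    IsSuperRegularAtDistance (A j) (lamSet (A j) (U j)) (U j) x (eps j)
  refl_nhd : ∀ j, (refl (A (j + 1))).image (U (j + 1)) ⊆ U j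
  refl_lam : ∀ j, (refl (A (j + 1))).image (lamSet (A (j + 1)) (U (j + 1))) ⊆ lamSet (A j) (U j)
  dr_lam : ∀ j, (relaxedDR lam (A j) (A (j + 1))).image (lamSet (A (j + 1)) (U (j + 1))) ⊆
    lamSet (A j) (U j)
  dr_nhd : ∀ j, (relaxedDR lam (A j) (A (j + 1))).image (U (j + 1)) ⊆ U j

/-- `y^{(m+1,k)} ∈ P_{A_{m+1}} y^{(k)}` and `y^{(i,k)} ∈ P_{A_i} y^{(i+1,k)}` for `i = m, …, 1`;
`s i k` stands for `y^{(i,k)}`, and `A_{m+1} = A_1`. -/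
def IsProjectionCycle {m : ℕ} (A : ZMod m → Set E) (y : ℕ → E) (s : ℕ → ℕ → E) : Prop :=
  ∀ k, s (m + 1) k ∈ proj (A ((m + 1 : ℕ) : ZMod m)) (y k) ∧
    ∀ i ∈ Finset.Icc 1 m, s i k ∈ proj (A (i : ZMod m)) (s (i + 1) k)

/-- The sum of the gaps at step `k`. -/
def gap (m : ℕ) (s : ℕ → ℕ → E) (k : ℕ) : ℝ := ∑ i ∈ Finset.Icc 1 m, ‖s (i + 1) k - s i k‖

end Operators

section Constants

/-- Violation of a reflector: `8 e (1 + e) / (1 - e) ^ 2`. -/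
noncomputable def reflViolation (e : ℝ) : ℝ := 8 * e * (1 + e) / (1 - e) ^ 2

/-- Violation of the two-set operator `T_{j,j+1}`, with `e = eps_j` and `e' = eps_{j+1}`. -/
noncomputable def drViolation (lam e e' : ℝ) : ℝ :=
  1 / 2 * ((lam * √(1 + reflViolation e) + 1 - lam) ^ 2 * (1 + reflViolation e') - 1)

/-- Violation of the cyclic operator. -/
noncomputable def cdrViolation {m : ℕ} (lam : ℝ) (eps : ZMod m → ℝ) : ℝ :=
  ∏ j ∈ Finset.Icc 1 m,
    (1 + drViolation lam (eps (j : ZMod m)) (eps ((j + 1 : ℕ) : ZMod m))) - 1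

/-- Averaging constant of the cyclic operator. -/
noncomputable def cdrAlpha (m : ℕ) : ℝ := m / (m + 1)

/-- Gauge functions on `[0, ∞)`. -/
structure IsGauge (ρ : ℝ≥0 → ℝ≥0) : Prop where
  continuous : Continuous ρ
  strictMono : StrictMono ρ
  map_zero : ρ 0 = 0
  tendsto_atTop : Tendsto ρ atTop atTop

/-- `θ` is the gauge `θ_{α,eps}` determined by the gauge `ρ` through
`ρ (√(((1 + eps) t² - θ(t)²) / ((1 - α) / α))) = t`, equivalently
`θ(t)² = (1 + eps) t² - ((1 - α) / α) ρ⁻¹(t)²`. -/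
structure IsThetaGauge (ρ θ : ℝ≥0 → ℝ≥0) (α eps : ℝ) : Prop where
  isGauge : IsGauge θ
  rel : ∀ t : ℝ≥0,
    ρ ⟨√(((1 + eps) * (t : ℝ) ^ 2 - (θ t : ℝ) ^ 2) / ((1 - α) / α)), Real.sqrt_nonneg _⟩ = t

end Constants

end CDR

open CDR

namespace CDR

section Distances

variable {E : Type*} [NormedAddCommGroup E]

/-! Gap convergence only needs the iterates $y^{(k)}$ to be Cauchy. Super-regularity makes $P_{A_j}$
Lipschitz between $\Lambda_j$ and $U_j$, so the Cauchy property passes down each projection cycle;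
the limits lie in the closed sets $A_j$, and a zero limiting gap makes them coincide
(`exists_tendsto_gap`).

For the Cauchy property, near-isometry of the reflectors gives
$\|y^{(k+1)}-z\|^2\le(1+\epsilon)\|y^{(k)}-z\|^2-\frac1m\|y^{(k+1)}-y^{(k)}\|^2$ at fixed points
$z\in U_1$ (`cyclicDR_norm_sq_le`). Let $t_k$ be the distance from $y^{(k)}$ to
$S=\mathrm{Fix}\,T\cap\Lambda_1$. Subregularity bounds the step below in terms of $t_k$, whence
$t_{k+1}\le\theta(t_k)$ in (i), and $t_{k+1}\le q\,t_k$ with $q<1$ in (ii) while the iterates stay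
near $\bar y$; steps are $O(t_k)$ in both. -/

theorem one_le_prod_real {ι : Type*} {s : Finset ι} {f : ι → ℝ} (h : ∀ i ∈ s, 1 ≤ f i) :
    1 ≤ ∏ i ∈ s, f i := by
  simpa using Finset.prod_le_prod (s := s) (f := fun _ => (1 : ℝ)) (fun _ _ => zero_le_one) h

/-- Weighted Cauchy-Schwarz, stated without dividing by `k` so that `k = 0` is allowed. It produces
the factor `1 / m` for a composition of `m` operators. -/
theorem norm_add_sq_le_of_sq_le {a b : E} {k X : ℝ} (hk : 0 ≤ k) (hX : 0 ≤ X)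
    (hb : ‖b‖ ^ 2 ≤ k * X) : ‖a + b‖ ^ 2 ≤ (k + 1) * (‖a‖ ^ 2 + X) := by
  have h1 : 2 * (‖a‖ * ‖b‖) ≤ k * ‖a‖ ^ 2 + X := by
    refine le_of_sq_le_sq ?_ (by positivity)
    calc (2 * (‖a‖ * ‖b‖)) ^ 2 = 4 * ‖a‖ ^ 2 * ‖b‖ ^ 2 := by ring
      _ ≤ 4 * ‖a‖ ^ 2 * (k * X) := by gcongr
      _ ≤ _ := by nlinarith [sq_nonneg (k * ‖a‖ ^ 2 - X)]
  calc ‖a + b‖ ^ 2 ≤ (‖a‖ + ‖b‖) ^ 2 := by gcongr; exact norm_add_le _ _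
    _ ≤ _ := by nlinarith

/-! ### Distances to the set of fixed points -/

/-- `S` need not be closed, so a nearest point is taken in its closure. The ball condition puts it
in the open set `V`, hence in the closure of `S ∩ V`, where the inequality persists by continuity.
-/
theorem infDist_sq_le [ProperSpace E] {S V : Set E} (hS : S.Nonempty) (hV : IsOpen V) {x x' : E}
    {a c : ℝ} (hball : Metric.closedBall x (Metric.infDist x S) ⊆ V)
    (h : ∀ z ∈ S ∩ V, ‖x' - z‖ ^ 2 ≤ a * ‖x - z‖ ^ 2 - c * dist x x' ^ 2) :
    Metric.infDist x' S ^ 2 ≤ a * Metric.infDist x S ^ 2 - c * dist x x' ^ 2 := by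
  obtain ⟨z, hz, hd⟩ := isClosed_closure.exists_infDist_eq_dist hS.closure x
  rw [Metric.infDist_closure] at hd
  have hzV : z ∈ V := hball (by rw [Metric.mem_closedBall', hd])
  have hz' : z ∈ closure (S ∩ V) := by
    rw [Set.inter_comm]; exact hV.inter_closure ⟨hzV, hz⟩
  have hcl : IsClosed {z : E | ‖x' - z‖ ^ 2 ≤ a * ‖x - z‖ ^ 2 - c * dist x x' ^ 2} :=
    isClosed_le (by fun_prop) (by fun_prop)
  have h1 : ‖x' - z‖ ^ 2 ≤ a * ‖x - z‖ ^ 2 - c * dist x x' ^ 2 := closure_minimal h hcl hz'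
  have h2 : Metric.infDist x' S ≤ ‖x' - z‖ := by
    rw [← Metric.infDist_closure, ← dist_eq_norm]
    exact Metric.infDist_le_dist_of_mem hz
  rw [hd, dist_eq_norm]
  refine le_trans ?_ h1
  gcongr
  exact Metric.infDist_nonneg

theorem infDist_le_of_infEDist_le {S Q : Set E} {x x' : E} {ρ : ℝ≥0 → ℝ≥0} (hρ : Monotone ρ)
    (hx' : x' ∈ Q)
    (h : Metric.infEDist x S ≤ (ρ (Metric.infNndist x Q) : ℝ≥0∞)) :
    Metric.infDist x S ≤ ρ (nndist x x') := by
  have h1 : Metric.infNndist x Q ≤ nndist x x' := by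
    rw [← NNReal.coe_le_coe, Metric.coe_infNndist, coe_nndist]
    exact Metric.infDist_le_dist_of_mem hx'
  have h2 : Metric.infEDist x S ≤ (ρ (nndist x x') : ℝ≥0∞) :=
    h.trans (ENNReal.coe_le_coe.2 (hρ h1))
  exact ENNReal.toReal_le_of_le_ofReal (by positivity) (by simpa using h2)

theorem IsThetaGauge.sq_sub_sq_le {ρ θ : ℝ≥0 → ℝ≥0} {α e : ℝ} (hρ : IsGauge ρ)
    (hθ : IsThetaGauge ρ θ α e) (hα : 0 < (1 - α) / α) {t d : ℝ≥0} (htd : t ≤ ρ d) :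
    (1 + e) * (t : ℝ) ^ 2 - (1 - α) / α * (d : ℝ) ^ 2 ≤ (θ t : ℝ) ^ 2 := by
  have h1 := hθ.rel t
  set w := ((1 + e) * (t : ℝ) ^ 2 - (θ t : ℝ) ^ 2) / ((1 - α) / α) with hw
  rw [← h1] at htd
  have h2 : √w ≤ d := hρ.strictMono.le_iff_le.1 htd
  have h3 : w ≤ (d : ℝ) ^ 2 := (Real.sqrt_le_left d.2).1 h2
  rw [hw, div_le_iff₀ hα] at h3
  linarith

/-! ### Criteria for the iterates to be Cauchy -/

theorem cauchySeq_of_infDist_tendsto_zero {S : Set E} (hS : S.Nonempty) {y : ℕ → E}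
    (hfejer : ∀ k, ∀ z ∈ S, dist (y (k + 1)) z ≤ dist (y k) z)
    (ht : Tendsto (fun k => Metric.infDist (y k) S) atTop (𝓝 0)) : CauchySeq y := by
  rw [Metric.cauchySeq_iff']
  intro r hr
  obtain ⟨N, hN⟩ := (ht.eventually_lt_const (half_pos hr)).exists
  obtain ⟨z, hz, hd⟩ := (Metric.infDist_lt_iff hS).1 hN
  refine ⟨N, fun n hn => ?_⟩
  have h1 : dist (y n) z ≤ dist (y N) z :=
    antitone_nat_of_succ_le (f := fun k => dist (y k) z) (fun k => hfejer k z hz) hn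
  linarith [dist_triangle_right (y n) (y N) z]

/-- `dist (y k) p + M / (1 - q) * t k` does not increase, since `M + q * M / (1 - q) = M / (1 - q)`;
this keeps the iterates where `hstep` applies. -/
theorem cauchySeq_of_local_linear {y : ℕ → E} {p : E} {t : ℕ → ℝ} {q M r : ℝ}
    (ht : ∀ k, 0 ≤ t k) (hq0 : 0 ≤ q) (hq1 : q < 1) (hM : 0 ≤ M)
    (h0 : dist (y 0) p + M / (1 - q) * t 0 + t 0 < r)
    (hstep : ∀ k, dist (y k) p + t k < r → t (k + 1) ≤ q * t k ∧ dist (y k) (y (k + 1)) ≤ M * t k) :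
    CauchySeq y := by
  have hq : 0 < 1 - q := sub_pos.2 hq1
  have hMq : 0 ≤ M / (1 - q) := div_nonneg hM hq.le
  have hin : ∀ k, dist (y k) p + M / (1 - q) * t k ≤ dist (y 0) p + M / (1 - q) * t 0 →
      t k ≤ q ^ k * t 0 → dist (y k) p + t k < r := fun k h1 h2 => by
    have h3 : q ^ k * t 0 ≤ t 0 := mul_le_of_le_one_left (ht 0) (pow_le_one₀ hq0 hq1.le)
    linarith [mul_nonneg hMq (ht k)]
  have key : ∀ k, dist (y k) p + M / (1 - q) * t k ≤ dist (y 0) p + M / (1 - q) * t 0 ∧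
      t k ≤ q ^ k * t 0 := by
    intro k
    induction k with
    | zero => simp
    | succ k ih =>
      obtain ⟨h1, h2⟩ := hstep k (hin k ih.1 ih.2)
      constructor
      · have h3 : M / (1 - q) * t (k + 1) ≤ M / (1 - q) * (q * t k) := by gcongr
        have h4 : M / (1 - q) * (q * t k) + M * t k = M / (1 - q) * t k := by
          field_simp; ring
        linarith [dist_triangle_left (y (k + 1)) p (y k), ih.1]
      · calc t (k + 1) ≤ q * t k := h1
          _ ≤ q * (q ^ k * t 0) := by gcongr; exact ih.2
          _ = _ := by ring
  refine cauchySeq_of_le_geometric q (M * t 0) hq1 fun k => ?_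
  calc dist (y k) (y (k + 1)) ≤ M * t k := (hstep k (hin k (key k).1 (key k).2)).2
    _ ≤ M * (q ^ k * t 0) := by gcongr; exact (key k).2
    _ = _ := by ring

theorem cauchySeq_of_thetaGauge [ProperSpace E] {S : Set E} (hS : S.Nonempty)
    {ρ θ : ℝ≥0 → ℝ≥0} {α e : ℝ} {tbar : ℝ≥0} (hα : 0 < (1 - α) / α) (he : 0 ≤ 1 + e)
    (hρ : IsGauge ρ) (hθ : IsThetaGauge ρ θ α e) {y : ℕ → E}
    (hstep : ∀ k, ∀ z ∈ S, ‖y (k + 1) - z‖ ^ 2 ≤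
      (1 + e) * ‖y k - z‖ ^ 2 - (1 - α) / α * dist (y k) (y (k + 1)) ^ 2)
    (hsub : ∀ k, Metric.infDist (y k) S ≤ ρ (nndist (y k) (y (k + 1))))
    (h0 : Metric.infDist (y 0) S < tbar)
    (h : ((∀ t, 0 < t → t < tbar → Tendsto (fun k => θ^[k] t) atTop (𝓝 0)) ∧
        (∀ k, ∀ z ∈ S, dist (y (k + 1)) z ≤ dist (y k) z)) ∨
      (∀ t, 0 < t → t < tbar → Summable (fun j : ℕ => θ^[j + 1] t))) : CauchySeq y := by
  have hd : ∀ k, Metric.infDist (y (k + 1)) S ^ 2 ≤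
      (1 + e) * Metric.infDist (y k) S ^ 2 - (1 - α) / α * dist (y k) (y (k + 1)) ^ 2 :=
    fun k => infDist_sq_le hS isOpen_univ (Set.subset_univ _) fun z hz => hstep k z hz.1
  have hθstep : ∀ k, Metric.infNndist (y (k + 1)) S ≤ θ (Metric.infNndist (y k) S) := by
    intro k
    have h1 : Metric.infNndist (y k) S ≤ ρ (nndist (y k) (y (k + 1))) := by
      rw [← NNReal.coe_le_coe, Metric.coe_infNndist]; exact hsub k
    have h2 := hθ.sq_sub_sq_le hρ hα h1
    rw [Metric.coe_infNndist, coe_nndist] at h2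
    rw [← NNReal.coe_le_coe, Metric.coe_infNndist]
    exact le_of_sq_le_sq ((hd k).trans h2) (NNReal.coe_nonneg _)
  -- The initial distance may be `0`, while the conditions on `θ` concern positive `t`; hence a
  -- larger starting value.
  obtain ⟨t, ht0, ht⟩ : ∃ t : ℝ≥0, max 0 (Metric.infNndist (y 0) S) < t ∧ t < tbar := by
    refine exists_between (max_lt ?_ ?_)
    · rw [← NNReal.coe_lt_coe]; exact Metric.infDist_nonneg.trans_lt h0
    · rw [← NNReal.coe_lt_coe, Metric.coe_infNndist]; exact h0
  have hmono := hθ.isGauge.strictMono.monotone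
  have hk : ∀ k, Metric.infNndist (y k) S ≤ θ^[k] t := by
    intro k
    induction k with
    | zero => exact ((le_max_right _ _).trans_lt ht0).le
    | succ k ih =>
      rw [Function.iterate_succ_apply']
      exact (hθstep k).trans (hmono ih)
  have hk' : ∀ k, Metric.infDist (y k) S ≤ (θ^[k] t : ℝ≥0) := fun k => by
    rw [← Metric.coe_infNndist]; exact NNReal.coe_le_coe.2 (hk k)
  have htpos : 0 < t := (le_max_left _ _).trans_lt ht0
  rcases h with ⟨h1, h2⟩ | h1
  · refine cauchySeq_of_infDist_tendsto_zero hS h2 ?_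
    exact squeeze_zero (fun _ => Metric.infDist_nonneg) hk'
      (by simpa using NNReal.tendsto_coe.2 (h1 t htpos ht))
  · have hsum : Summable fun k => θ^[k] t := by
      rw [← NNReal.summable_coe, ← summable_nat_add_iff 1]
      exact NNReal.summable_coe.2 (h1 t htpos ht)
    set C := √((1 + e) / ((1 - α) / α)) with hC
    refine cauchySeq_of_summable_dist
      (Summable.of_nonneg_of_le (fun _ => dist_nonneg) (fun k => ?_)
        ((NNReal.summable_coe.2 hsum).mul_left C))
    refine le_trans (b := C * Metric.infDist (y k) S) (le_of_sq_le_sq ?_ ?_) ?_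
    · have h3 := hd k
      have h4 := sq_nonneg (Metric.infDist (y (k + 1)) S)
      rw [mul_pow, hC, Real.sq_sqrt (div_nonneg he hα.le), div_mul_eq_mul_div, le_div_iff₀ hα]
      linarith
    · exact mul_nonneg (Real.sqrt_nonneg _) Metric.infDist_nonneg
    · exact mul_le_mul_of_nonneg_left (hk' k) (Real.sqrt_nonneg _)

end Distances

section Operators

variable {E : Type*} [NormedAddCommGroup E] [InnerProductSpace ℝ E]

/-! ### Regularity of projectors and reflectors -/

theorem reflViolation_nonneg {e : ℝ} (he0 : 0 ≤ e) : 0 ≤ reflViolation e := by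
  unfold reflViolation; positivity

/-- Here `D`, `q` and `D - q` are the differences of two points, of their projections and of the
residuals. Expanding the squares bounds each of `‖q‖`, `‖D - q‖` by `‖D‖` plus `e` times the other.
-/
theorem norm_le_of_inner_ge {D q : E} {e : ℝ} (he0 : 0 ≤ e) (he1 : e < 1)
    (h : -(e * ‖D - q‖ * ‖q‖) ≤ inner ℝ (D - q) q) :
    ‖q‖ ≤ ‖D‖ / (1 - e) ∧ ‖D - q‖ ≤ ‖D‖ / (1 - e) := by
  have h1 : ‖q‖ ^ 2 = inner ℝ q D - inner ℝ (D - q) q := by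
    rw [inner_sub_left, real_inner_self_eq_norm_sq, real_inner_comm]; ring
  have h2 : ‖D - q‖ ^ 2 = inner ℝ (D - q) D - inner ℝ (D - q) q := by
    rw [← inner_sub_right, real_inner_self_eq_norm_sq]
  have h3 := real_inner_le_norm q D
  have h4 := real_inner_le_norm (D - q) D
  have hq := norm_nonneg q
  have hDq := norm_nonneg (D - q)
  have h5 : ‖q‖ ≤ ‖D‖ + e * ‖D - q‖ := by
    rcases hq.eq_or_lt with h0 | h0
    · rw [← h0]; positivity
    · refine le_of_mul_le_mul_left ?_ h0
      nlinarith
  have h6 : ‖D - q‖ ≤ ‖D‖ + e * ‖q‖ := by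
    rcases hDq.eq_or_lt with h0 | h0
    · rw [← h0]; positivity
    · refine le_of_mul_le_mul_left ?_ h0
      nlinarith
  have he : 0 < 1 - e := by linarith
  constructor
  · rw [le_div_iff₀ he]
    have h7 := mul_le_mul_of_nonneg_left h6 he0
    refine le_of_mul_le_mul_left (a := 1 + e) ?_ (by linarith)
    nlinarith
  · rw [le_div_iff₀ he]
    have h7 := mul_le_mul_of_nonneg_left h5 he0
    refine le_of_mul_le_mul_left (a := 1 + e) ?_ (by linarith)
    nlinarith

theorem norm_two_smul_sub_sq_le {D q : E} {e : ℝ} (he0 : 0 ≤ e) (he1 : e < 1)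
    (h : -(e * ‖D - q‖ * ‖q‖) ≤ inner ℝ (D - q) q) :
    ‖(2 : ℝ) • q - D‖ ^ 2 ≤ (1 + reflViolation e) * ‖D‖ ^ 2 := by
  obtain ⟨h1, h2⟩ := norm_le_of_inner_ge he0 he1 h
  have he : 0 < 1 - e := by linarith
  -- The error is at most `4 * e / (1 - e) ^ 2 * ‖D‖ ^ 2`; `reflViolation` leaves room to spare.
  have h3 : ‖(2 : ℝ) • q - D‖ ^ 2 = ‖D‖ ^ 2 - 4 * inner ℝ (D - q) q := by
    rw [norm_sub_sq_real, inner_sub_left, norm_smul, inner_smul_left,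
      real_inner_self_eq_norm_sq, real_inner_comm q D]
    norm_num
    ring
  have h4 : ‖D - q‖ * ‖q‖ ≤ ‖D‖ / (1 - e) * (‖D‖ / (1 - e)) :=
    mul_le_mul h2 h1 (norm_nonneg _) (by positivity)
  have h5 : reflViolation e * ‖D‖ ^ 2 =
      8 * (1 + e) * (e * (‖D‖ / (1 - e) * (‖D‖ / (1 - e)))) := by
    unfold reflViolation
    field_simp
  have h6 := mul_le_mul_of_nonneg_left h4 he0
  have h7 : 0 ≤ e * (‖D‖ / (1 - e) * (‖D‖ / (1 - e))) := by positivity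
  nlinarith

theorem IsSuperRegularAtDistance.inner_ge {Ω U : Set E} {xbar : E} {e : ℝ}
    (h : IsSuperRegularAtDistance Ω (lamSet Ω U) U xbar e) {x z p q : E}
    (hx : x ∈ lamSet Ω U) (hz : z ∈ U) (hp : p ∈ proj Ω x) (hq : q ∈ proj Ω z) :
    -(e * ‖(x - z) - (p - q)‖ * ‖p - q‖) ≤ inner ℝ ((x - z) - (p - q)) (p - q) := by
  have h1 := h.2.2 x ⟨hx.2, hx⟩ p hp q (z - q)
    ⟨1, zero_le_one, z, hq, by simp⟩ (by simpa using hz) (by simpa using hq)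
  have h2 : z - q - (x - p) = -((x - z) - (p - q)) := by abel
  rw [h2, inner_neg_left, norm_neg] at h1
  linarith

variable {m : ℕ} {lam : ℝ} {A U : ZMod m → Set E} {eps : ZMod m → ℝ}

theorem StandingAssumption.norm_proj_sub_le (hA : StandingAssumption lam A U eps) {j : ZMod m}
    {x z p q : E} (hx : x ∈ lamSet (A j) (U j)) (hz : z ∈ U j)
    (hp : p ∈ proj (A j) x) (hq : q ∈ proj (A j) z) :
    ‖p - q‖ ≤ ‖x - z‖ / (1 - eps j) := by
  obtain ⟨a, -, ha⟩ := hA.superRegular j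
  exact (norm_le_of_inner_ge (hA.eps_nonneg j) (hA.eps_lt_one j) (ha.inner_ge hx hz hp hq)).1

theorem StandingAssumption.norm_refl_sub_le (hA : StandingAssumption lam A U eps) {j : ZMod m}
    {x z p q : E} (hx : x ∈ lamSet (A j) (U j)) (hz : z ∈ U j)
    (hp : p ∈ refl (A j) x) (hq : q ∈ refl (A j) z) :
    ‖p - q‖ ≤ √(1 + reflViolation (eps j)) * ‖x - z‖ := by
  obtain ⟨a, -, ha⟩ := hA.superRegular j
  obtain ⟨p, hp, rfl⟩ := hp
  obtain ⟨q, hq, rfl⟩ := hq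
  have h := norm_two_smul_sub_sq_le (hA.eps_nonneg j) (hA.eps_lt_one j)
    (ha.inner_ge hx hz hp hq)
  have h1 : (2 : ℝ) • p - x - ((2 : ℝ) • q - z) = (2 : ℝ) • (p - q) - (x - z) := by
    rw [smul_sub]; abel
  have h0 : 0 ≤ 1 + reflViolation (eps j) := by
    linarith [reflViolation_nonneg (hA.eps_nonneg j)]
  rw [h1]
  refine le_of_sq_le_sq ?_ (by positivity)
  rwa [mul_pow, Real.sq_sqrt h0]

/-! ### The relaxed and the cyclic Douglas-Rachford operators -/

theorem drViolation_nonneg {e e' : ℝ} (hlam0 : 0 ≤ lam) (he : 0 ≤ e) (he' : 0 ≤ e') :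
    0 ≤ drViolation lam e e' := by
  have h1 : 1 ≤ √(1 + reflViolation e) :=
    Real.one_le_sqrt.2 (by linarith [reflViolation_nonneg he])
  have h2 := reflViolation_nonneg he'
  have h3 : 1 ≤ lam * √(1 + reflViolation e) + 1 - lam := by nlinarith
  have h4 : 1 ≤ (lam * √(1 + reflViolation e) + 1 - lam) ^ 2 := one_le_pow₀ h3
  unfold drViolation
  nlinarith

/-- The operator averages the identity with `lam • R_A R_B + (1 - lam) • R_B`, whose Lipschitz bound
`l` comes from the reflectors. The parallelogram law then gives the violation `(l ^ 2 - 1) / 2`. -/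
theorem StandingAssumption.relaxedDR_norm_sq_le (hA : StandingAssumption lam A U eps)
    (hlam0 : 0 ≤ lam) (hlam1 : lam ≤ 1) {j : ZMod m} {x z x' z' : E}
    (hx : x ∈ lamSet (A (j + 1)) (U (j + 1))) (hz : z ∈ U (j + 1))
    (hx' : x' ∈ relaxedDR lam (A j) (A (j + 1)) x)
    (hz' : z' ∈ relaxedDR lam (A j) (A (j + 1)) z) :
    ‖x' - z'‖ ^ 2 ≤ (1 + drViolation lam (eps j) (eps (j + 1))) * ‖x - z‖ ^ 2 -
      ‖(x' - z') - (x - z)‖ ^ 2 := by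
  obtain ⟨r, hr, p, hp, rfl⟩ := hx'
  obtain ⟨s, hs, q, hq, rfl⟩ := hz'
  obtain ⟨u, hu, hr⟩ := Set.mem_iUnion₂.1 hr
  obtain ⟨v, hv, hs⟩ := Set.mem_iUnion₂.1 hs
  have hu' := hA.refl_lam j (Set.mem_iUnion₂.2 ⟨x, hx, hu⟩)
  have hv' := hA.refl_nhd j (Set.mem_iUnion₂.2 ⟨z, hz, hv⟩)
  have h1 := hA.norm_refl_sub_le hx hz hu hv
  have h2 := hA.norm_refl_sub_le hu' hv' hr hs
  -- In the Minkowski sum, `p` need not be the projection used in `u`, so its reflection is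
  -- estimated separately.
  have h3 := hA.norm_refl_sub_le hx hz ⟨p, hp, rfl⟩ ⟨q, hq, rfl⟩
  set a := √(1 + reflViolation (eps j)) with ha
  set b := √(1 + reflViolation (eps (j + 1))) with hb
  have hb2 : b ^ 2 = 1 + reflViolation (eps (j + 1)) :=
    Real.sq_sqrt (by linarith [reflViolation_nonneg (hA.eps_nonneg (j + 1))])
  have ha0 : 0 ≤ a := Real.sqrt_nonneg _
  set w := lam • (r - s) + (1 - lam) • ((2 : ℝ) • p - x - ((2 : ℝ) • q - z)) with hw
  have h4 : ‖w‖ ≤ (lam * a + 1 - lam) * b * ‖x - z‖ := by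
    calc ‖w‖ ≤ lam * ‖r - s‖ + (1 - lam) * ‖(2 : ℝ) • p - x - ((2 : ℝ) • q - z)‖ := by
          refine (norm_add_le _ _).trans_eq ?_
          rw [norm_smul, norm_smul, Real.norm_of_nonneg hlam0,
            Real.norm_of_nonneg (sub_nonneg.2 hlam1)]
      _ ≤ lam * (a * (b * ‖x - z‖)) + (1 - lam) * (b * ‖x - z‖) := by
          have : ‖r - s‖ ≤ a * (b * ‖x - z‖) := h2.trans (by gcongr)
          have := sub_nonneg.2 hlam1
          gcongr
      _ = _ := by ring
  have h5 : ‖w‖ ^ 2 ≤ (lam * a + 1 - lam) ^ 2 * b ^ 2 * ‖x - z‖ ^ 2 := by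
    calc ‖w‖ ^ 2 ≤ ((lam * a + 1 - lam) * b * ‖x - z‖) ^ 2 := by gcongr
      _ = _ := by ring
  have h6 : (lam / 2) • (r + x) + (1 - lam) • p - ((lam / 2) • (s + z) + (1 - lam) • q) =
      (1 / 2 : ℝ) • (w + (x - z)) := by
    rw [hw]; module
  have h7 : (1 / 2 : ℝ) • (w + (x - z)) - (x - z) = (1 / 2 : ℝ) • (w - (x - z)) := by
    module
  have h8 := parallelogram_law_with_norm ℝ w (x - z)
  rw [h6, h7, norm_smul, norm_smul]
  rw [hb2] at h5
  unfold drViolation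
  rw [← ha]
  norm_num
  nlinarith

theorem StandingAssumption.partialCDR_norm_sq_le (hA : StandingAssumption lam A U eps)
    (hlam0 : 0 ≤ lam) (hlam1 : lam ≤ 1) (k : ℕ) {x z x' z' : E}
    (hx : x ∈ lamSet (A ((k + 1 : ℕ) : ZMod m)) (U ((k + 1 : ℕ) : ZMod m)))
    (hz : z ∈ U ((k + 1 : ℕ) : ZMod m))
    (hx' : x' ∈ partialCDR lam A k x) (hz' : z' ∈ partialCDR lam A k z) :
    x' ∈ lamSet (A 1) (U 1) ∧
    ‖x' - z'‖ ^ 2 ≤ (∏ j ∈ Finset.Icc 1 k,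
      (1 + drViolation lam (eps (j : ZMod m)) (eps ((j + 1 : ℕ) : ZMod m)))) * ‖x - z‖ ^ 2 ∧
    ‖(x' - z') - (x - z)‖ ^ 2 ≤ k * ((∏ j ∈ Finset.Icc 1 k,
      (1 + drViolation lam (eps (j : ZMod m)) (eps ((j + 1 : ℕ) : ZMod m)))) * ‖x - z‖ ^ 2 -
        ‖x' - z'‖ ^ 2) := by
  induction k generalizing x z with
  | zero =>
    obtain rfl : x' = x := hx'
    obtain rfl : z' = z := hz'
    exact ⟨by simpa using hx, by simp, by simp⟩
  | succ k ih =>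
    obtain ⟨u, hu, hx'⟩ := Set.mem_iUnion₂.1 hx'
    obtain ⟨v, hv, hz'⟩ := Set.mem_iUnion₂.1 hz'
    have hc : ((k + 2 : ℕ) : ZMod m) = ((k + 1 : ℕ) : ZMod m) + 1 := by push_cast; ring
    rw [show k + 1 + 1 = k + 2 from rfl, hc] at hx hz
    rw [hc] at hu hv
    have hu' := hA.dr_lam _ (Set.mem_iUnion₂.2 ⟨x, hx, hu⟩)
    have hv' := hA.dr_nhd _ (Set.mem_iUnion₂.2 ⟨z, hz, hv⟩)
    have h1 := hA.relaxedDR_norm_sq_le hlam0 hlam1 hx hz hu hv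
    obtain ⟨h0, h2, h3⟩ := ih hu' hv' hx' hz'
    rw [Finset.prod_Icc_succ_top (Nat.le_add_left 1 k), show k + 1 + 1 = k + 2 from rfl, hc]
    set Q := ∏ j ∈ Finset.Icc 1 k,
      (1 + drViolation lam (eps (j : ZMod m)) (eps ((j + 1 : ℕ) : ZMod m))) with hQ
    have hQ1 : 1 ≤ Q := one_le_prod_real fun j _ => by
      linarith [drViolation_nonneg hlam0 (hA.eps_nonneg j) (hA.eps_nonneg ((j + 1 : ℕ) : ZMod m))]
    set d := 1 + drViolation lam (eps ((k + 1 : ℕ) : ZMod m)) (eps (((k + 1 : ℕ) : ZMod m) + 1))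
    -- The one-operator estimate times `Q`; as `1 ≤ Q`, the displacement term may keep coefficient
    -- `1`. Adding the bound from `ih` cancels `Q * ‖u - v‖ ^ 2`.
    have h4 : ‖u - v - (x - z)‖ ^ 2 ≤ Q * d * ‖x - z‖ ^ 2 - Q * ‖u - v‖ ^ 2 := by
      nlinarith [sq_nonneg ‖u - v - (x - z)‖]
    refine ⟨h0, by nlinarith [sq_nonneg ‖u - v - (x - z)‖], ?_⟩
    have h5 := norm_add_sq_le_of_sq_le (a := u - v - (x - z)) (Nat.cast_nonneg k)
      (sub_nonneg.2 h2) h3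
    rw [add_comm, sub_add_sub_cancel] at h5
    push_cast
    refine h5.trans ?_
    gcongr
    linarith

theorem one_le_one_add_cdrViolation (hA : StandingAssumption lam A U eps) (hlam0 : 0 ≤ lam) :
    1 ≤ 1 + cdrViolation lam eps := by
  unfold cdrViolation
  rw [add_sub_cancel]
  exact one_le_prod_real fun j _ => by
    linarith [drViolation_nonneg hlam0 (hA.eps_nonneg j) (hA.eps_nonneg ((j + 1 : ℕ) : ZMod m))]

theorem one_sub_cdrAlpha_div (hm : m ≠ 0) : (1 - cdrAlpha m) / cdrAlpha m = 1 / m := by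
  unfold cdrAlpha
  have : (m : ℝ) ≠ 0 := Nat.cast_ne_zero.2 hm
  have : (m : ℝ) + 1 ≠ 0 := by positivity
  field_simp
  ring

theorem StandingAssumption.cyclicDR_norm_sq_le (hA : StandingAssumption lam A U eps)
    (hlam0 : 0 ≤ lam) (hlam1 : lam ≤ 1) (hm : m ≠ 0) {x z x' z' : E}
    (hx : x ∈ lamSet (A 1) (U 1)) (hz : z ∈ U 1)
    (hx' : x' ∈ cyclicDR lam A x) (hz' : z' ∈ cyclicDR lam A z) :
    ‖x' - z'‖ ^ 2 ≤ (1 + cdrViolation lam eps) * ‖x - z‖ ^ 2 -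
      (1 - cdrAlpha m) / cdrAlpha m * ‖(x' - z') - (x - z)‖ ^ 2 := by
  have hc : ((m + 1 : ℕ) : ZMod m) = 1 := by simp
  have h := (hA.partialCDR_norm_sq_le hlam0 hlam1 m (hc.symm ▸ hx) (hc.symm ▸ hz) hx' hz').2.2
  rw [one_sub_cdrAlpha_div hm]
  have hm' : (0 : ℝ) < m := Nat.cast_pos.2 hm.bot_lt
  rw [← div_le_iff₀' hm'] at h
  unfold cdrViolation
  rw [add_sub_cancel, one_div_mul_eq_div]
  linarith

theorem StandingAssumption.cyclicDR_mem_lamSet (hA : StandingAssumption lam A U eps)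
    (hlam0 : 0 ≤ lam) (hlam1 : lam ≤ 1) {x x' : E}
    (hx : x ∈ lamSet (A 1) (U 1)) (hx' : x' ∈ cyclicDR lam A x) : x' ∈ lamSet (A 1) (U 1) := by
  have hc : ((m + 1 : ℕ) : ZMod m) = 1 := by simp
  exact (hA.partialCDR_norm_sq_le hlam0 hlam1 m (hc.symm ▸ hx) (hc.symm ▸ hx.2) hx' hx').1

/-- Displacement at a point of `Λ_1` near a fixed point. -/
theorem StandingAssumption.dist_cyclicDR_le (hA : StandingAssumption lam A U eps)
    (hlam0 : 0 ≤ lam) (hlam1 : lam ≤ 1) (hm : m ≠ 0) {x x' z : E}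
    (hx : x ∈ lamSet (A 1) (U 1)) (hx' : x' ∈ cyclicDR lam A x)
    (hz : z ∈ (cyclicDR lam A).fix) (hzU : z ∈ U 1) :
    dist x x' ≤ (2 + cdrViolation lam eps) * dist x z := by
  have h := hA.cyclicDR_norm_sq_le hlam0 hlam1 hm hx hzU hx' hz
  have h1 := one_le_one_add_cdrViolation hA hlam0
  have h2 : dist x' z ≤ (1 + cdrViolation lam eps) * dist x z := by
    rw [dist_eq_norm, dist_eq_norm]
    refine le_of_sq_le_sq ?_ (by positivity)
    rw [one_sub_cdrAlpha_div hm] at h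
    have h3 : 0 ≤ 1 / (m : ℝ) * ‖(x' - z) - (x - z)‖ ^ 2 := by positivity
    nlinarith [sq_nonneg ‖x - z‖]
  linarith [dist_triangle_right x x' z]

/-! ### Convergence of the gaps -/

theorem StandingAssumption.cauchySeq_proj (hA : StandingAssumption lam A U eps) {j : ZMod m}
    {u v : ℕ → E} (hu : ∀ k, u k ∈ lamSet (A j) (U j)) (hv : ∀ k, v k ∈ proj (A j) (u k))
    (hc : CauchySeq u) : CauchySeq v := by
  have he : 0 < 1 - eps j := sub_pos.2 (hA.eps_lt_one j)
  rw [Metric.cauchySeq_iff] at hc ⊢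
  intro r hr
  obtain ⟨N, hN⟩ := hc (r * (1 - eps j)) (mul_pos hr he)
  refine ⟨N, fun a ha b hb => ?_⟩
  have h1 := hN a ha b hb
  rw [dist_eq_norm] at h1 ⊢
  refine (hA.norm_proj_sub_le (hu a) (hu b).2 (hv a) (hv b)).trans_lt ?_
  rwa [div_lt_iff₀ he]

theorem StandingAssumption.exists_tendsto_gap [CompleteSpace E]
    (hA : StandingAssumption lam A U eps) (hm : m ≠ 0)
    (hPlam : ∀ i, (proj (A (i + 1))).image (lamSet (A (i + 1)) (U (i + 1))) ⊆ lamSet (A i) (U i))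
    {y : ℕ → E} {s : ℕ → ℕ → E} (hy : ∀ k, y k ∈ lamSet (A 1) (U 1)) (hc : CauchySeq y)
    (hs : IsProjectionCycle A y s) :
    ∃ g : ℝ, 0 ≤ g ∧ Tendsto (gap m s) atTop (𝓝 g) ∧ (g = 0 → (⋂ j, A j).Nonempty) := by
  have : NeZero m := ⟨hm⟩
  have key : ∀ i ≤ m, CauchySeq (s (i + 1)) ∧
      (∀ k, s (i + 1) k ∈ lamSet (A (i : ZMod m)) (U (i : ZMod m))) ∧
      ∀ k, s (i + 1) k ∈ A ((i + 1 : ℕ) : ZMod m) := by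
    intro i hi
    induction hi using Nat.decreasingInduction with
    | self =>
      have hc1 : ((m + 1 : ℕ) : ZMod m) = (m : ZMod m) + 1 := by push_cast; rfl
      have hp : ∀ k, s (m + 1) k ∈ proj (A ((m : ZMod m) + 1)) (y k) := fun k =>
        hc1 ▸ (hs k).1
      have hy' : ∀ k, y k ∈ lamSet (A ((m : ZMod m) + 1)) (U ((m : ZMod m) + 1)) := by
        simpa using hy
      exact ⟨hA.cauchySeq_proj hy' hp hc,
        fun k => hPlam _ (Set.mem_iUnion₂.2 ⟨y k, hy' k, hp k⟩), fun k => hc1 ▸ (hp k).1⟩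
    | of_succ n hn ih =>
      obtain ⟨h1, h2, -⟩ := ih
      have hc1 : ((n + 1 : ℕ) : ZMod m) = (n : ZMod m) + 1 := by push_cast; rfl
      have hp : ∀ k, s (n + 1) k ∈ proj (A ((n + 1 : ℕ) : ZMod m)) (s (n + 1 + 1) k) :=
        fun k => (hs k).2 (n + 1) (Finset.mem_Icc.2 ⟨by omega, hn⟩)
      refine ⟨hA.cauchySeq_proj h2 hp h1, fun k => hPlam _ ?_, fun k => (hp k).1⟩
      rw [← hc1]
      exact Set.mem_iUnion₂.2 ⟨_, h2 k, hp k⟩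
  -- `l i` is the limit of `s (i + 1)`, hence lies in `A (i + 1)`; beyond `m` it is a dummy value.
  have hlim : ∀ i, ∃ l : E, i ≤ m → Tendsto (s (i + 1)) atTop (𝓝 l) := by
    intro i
    by_cases hi : i ≤ m
    · obtain ⟨l, hl⟩ := cauchySeq_tendsto_of_complete (key i hi).1
      exact ⟨l, fun _ => hl⟩
    · exact ⟨0, fun h => absurd h hi⟩
  choose l hl using hlim
  have hlA : ∀ i ≤ m, l i ∈ A ((i + 1 : ℕ) : ZMod m) := fun i hi =>
    (hA.isClosed _).mem_of_tendsto (hl i hi) (Eventually.of_forall (key i hi).2.2)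
  refine ⟨∑ i ∈ Finset.Icc 1 m, ‖l i - l (i - 1)‖, Finset.sum_nonneg fun _ _ => norm_nonneg _,
    ?_, fun h0 => ?_⟩
  · refine tendsto_finsetSum _ fun i hi => ?_
    obtain ⟨hi1, hi2⟩ := Finset.mem_Icc.1 hi
    have h1 := hl (i - 1) (by omega)
    rw [Nat.sub_add_cancel hi1] at h1
    exact ((hl i hi2).sub h1).norm
  · rw [Finset.sum_eq_zero_iff_of_nonneg fun _ _ => norm_nonneg _] at h0
    have heq : ∀ i ≤ m, l i = l 0 := by
      intro i
      induction i with
      | zero => intro _; rfl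
      | succ n ih =>
        intro hn
        have h1 := h0 (n + 1) (Finset.mem_Icc.2 ⟨by omega, hn⟩)
        rw [norm_eq_zero, sub_eq_zero] at h1
        exact h1.trans (ih (by omega))
    refine ⟨l 0, Set.mem_iInter.2 fun j => ?_⟩
    have h1 := hlA (j - 1).val (ZMod.val_lt _).le
    rw [heq _ (ZMod.val_lt _).le] at h1
    simpa using h1

end Operators

end CDR

/-! ### Choice of the radius `δ` in the two cases -/

theorem corollary4p9
    {E : Type*} [NormedAddCommGroup E] [InnerProductSpace ℝ E] [FiniteDimensional ℝ E]
    (m : ℕ) (hm : 2 ≤ m) (lam : ℝ) (hlam0 : 0 ≤ lam) (hlam1 : lam ≤ 1)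
    (A U : ZMod m → Set E) (eps : ZMod m → ℝ)
    -- a fixed point of `T`, and neighborhoods for which the standing assumption holds
    (ybar : E) (hfix : ybar ∈ (cyclicDR lam A).fix) (hU : ybar ∈ U 1)
    (hA : StandingAssumption lam A U eps)
    -- metric subregularity with gauge `ρ`; the distance to the empty set is `∞`
    (ρ : ℝ≥0 → ℝ≥0) (hρ : IsGauge ρ)
    (hsub : ∀ x ∈ U 1 ∩ lamSet (A 1) (U 1),
      Metric.infEDist x ((cyclicDR lam A).fix ∩ lamSet (A 1) (U 1)) ≤
        (ρ (Metric.infNndist x (cyclicDR lam A x)) : ℝ≥0∞))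
    -- the projectors map the sets forward
    (hPlam : ∀ i, (proj (A (i + 1))).image (lamSet (A (i + 1)) (U (i + 1))) ⊆
      lamSet (A i) (U i))
    (hPU : ∀ i, (proj (A (i + 1))).image (U (i + 1)) ⊆ U i) :
    -- convergence under one of the two conditions on the gauge `θ`
    (∀ (θ : ℝ≥0 → ℝ≥0) (tbar : ℝ≥0), 0 < tbar →
      IsThetaGauge ρ θ (cdrAlpha m) (cdrViolation lam eps) →
      (∀ t, 0 < t → t ≤ tbar → 0 < θ t ∧ θ t < t) →
      ∃ δ : ℝ, 0 < δ ∧ ∀ (y : ℕ → E) (s : ℕ → ℕ → E),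
        y 0 ∈ lamSet (A 1) (U 1) →
        Metric.infDist (y 0) ((cyclicDR lam A).fix ∩ U 1) < δ →
        (∀ k, y (k + 1) ∈ cyclicDR lam A (y k)) →
        (((∀ t, 0 < t → t < tbar → Tendsto (fun k => θ^[k] t) atTop (𝓝 0)) ∧
            (∀ k, ∀ z ∈ (cyclicDR lam A).fix, dist (y (k + 1)) z ≤ dist (y k) z)) ∨
          (∀ t, 0 < t → t < tbar → Summable (fun j : ℕ => θ^[j + 1] t))) →
        IsProjectionCycle A y s →
        ∃ g : ℝ, 0 ≤ g ∧ Tendsto (gap m s) atTop (𝓝 g) ∧ (g = 0 → (⋂ j, A j).Nonempty)) ∧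
    -- convergence for a linear gauge and arbitrarily small violations near `ybar`
    (∀ (α : ℝ) (κ : ℝ≥0), 0 < α → α < 1 → 0 < κ → (∀ t, ρ t = κ * t) →
      (∀ e : ℝ, 0 < e → e < 1 → ∃ V : Set E, IsOpen V ∧ ybar ∈ V ∧
        ∀ z ∈ (cyclicDR lam A).fix ∩ lamSet (A 1) (U 1) ∩ V,
          IsPointwiseAFNE (cyclicDR lam A) V z α e) →
      ∃ δ : ℝ, 0 < δ ∧ ∀ (y : ℕ → E) (s : ℕ → ℕ → E),
        y 0 ∈ lamSet (A 1) (U 1) →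
        dist (y 0) ybar < δ →
        (∀ k, y (k + 1) ∈ cyclicDR lam A (y k)) →
        IsProjectionCycle A y s →
        ∃ g : ℝ, 0 ≤ g ∧ Tendsto (gap m s) atTop (𝓝 g) ∧ (g = 0 → (⋂ j, A j).Nonempty)) := by
  have hm0 : m ≠ 0 := by omega
  set S := (cyclicDR lam A).fix ∩ lamSet (A 1) (U 1) with hS
  set L := 2 + cdrViolation lam eps with hL
  have hL0 : 0 < L := by linarith [one_le_one_add_cdrViolation hA hlam0]
  have hmem : ∀ y : ℕ → E, y 0 ∈ lamSet (A 1) (U 1) → (∀ k, y (k + 1) ∈ cyclicDR lam A (y k)) →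
      ∀ k, y k ∈ lamSet (A 1) (U 1) := by
    intro y h0 hy k
    induction k with
    | zero => exact h0
    | succ k ih => exact hA.cyclicDR_mem_lamSet hlam0 hlam1 ih (hy k)
  -- An empty `S` would be at infinite distance, against the finite bound from subregularity.
  have hSne : ∀ x ∈ lamSet (A 1) (U 1), S.Nonempty := by
    intro x hx
    by_contra hne
    have h1 := hsub x ⟨hx.2, hx⟩
    rw [Set.not_nonempty_iff_eq_empty.1 hne, Metric.infEDist_empty] at h1
    exact absurd h1 (by simp)
  have hsub' : ∀ x ∈ lamSet (A 1) (U 1), ∀ x' ∈ cyclicDR lam A x,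
      Metric.infDist x S ≤ ρ (nndist x x') := fun x hx x' hx' =>
    infDist_le_of_infEDist_le hρ.strictMono.monotone hx' (hsub x ⟨hx.2, hx⟩)
  constructor
  · intro θ tbar htbar hθ _
    obtain ⟨η, hη0, hη⟩ : ∃ η > 0, ∀ d : ℝ≥0, (d : ℝ) < η → ρ d < tbar := by
      have h1 := hρ.continuous.tendsto 0
      rw [hρ.map_zero] at h1
      obtain ⟨η, hη0, hη⟩ := Metric.eventually_nhds_iff.1 (h1.eventually_lt_const htbar)
      exact ⟨η, hη0, fun d hd => hη (by simpa [NNReal.dist_eq] using hd)⟩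
    -- Within `η / L` of a fixed point in `U 1` the first step is shorter than `η`, so subregularity
    -- puts `y 0` within `tbar` of `S`.
    refine ⟨η / L, by positivity, fun y s h0 hd hy hcond hs => ?_⟩
    have hΛ := hmem y h0 hy
    refine hA.exists_tendsto_gap hm0 hPlam hΛ ?_ hs
    have hα : 0 < (1 - cdrAlpha m) / cdrAlpha m := by
      rw [one_sub_cdrAlpha_div hm0]; positivity
    refine cauchySeq_of_thetaGauge (S := S) (tbar := tbar) (hSne _ h0) hα
      (zero_le_one.trans (one_le_one_add_cdrViolation hA hlam0)) hρ hθ (fun k z hz => ?_)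
      (fun k => hsub' _ (hΛ k) _ (hy k)) ?_ ?_
    · have h1 := hA.cyclicDR_norm_sq_le hlam0 hlam1 hm0 (hΛ k) hz.2.2 (hy k) hz.1
      rwa [sub_sub_sub_cancel_right, ← dist_eq_norm (y (k + 1)) (y k), dist_comm (y (k + 1))] at h1
    · have hne : ((cyclicDR lam A).fix ∩ U 1).Nonempty := ⟨ybar, hfix, hU⟩
      obtain ⟨z, hz, hdz⟩ := (Metric.infDist_lt_iff hne).1 hd
      have h1 := hA.dist_cyclicDR_le hlam0 hlam1 hm0 h0 (hy 0) hz.1 hz.2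
      rw [lt_div_iff₀' hL0] at hdz
      refine (hsub' _ h0 _ (hy 0)).trans_lt (NNReal.coe_lt_coe.2 (hη _ ?_))
      rw [coe_nndist]
      exact h1.trans_lt hdz
    · exact hcond.imp_left fun h => ⟨h.1, fun k z hz => h.2 k z hz.1⟩
  · intro α κ hα0 hα1 hκ hlin hafne
    have hκ' : (0 : ℝ) < κ := hκ
    obtain ⟨c, hc⟩ : ∃ c, c = (1 - α) / α := ⟨_, rfl⟩
    have hc0 : 0 < c := hc ▸ div_pos (sub_pos.2 hα1) hα0
    -- The bound `e < c / κ ^ 2` is what makes `q < 1`.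
    obtain ⟨e, he0, he⟩ : ∃ e : ℝ, 0 < e ∧ e < min 1 (c / κ ^ 2) :=
      exists_between (lt_min one_pos (by positivity))
    obtain ⟨V, hV, hyV, hT⟩ := hafne e he0 (he.trans_le (min_le_left _ _))
    obtain ⟨r, hr0, hr⟩ := Metric.isOpen_iff.1 hV ybar hyV
    set q := √(1 + e - c / κ ^ 2) with hq
    have hq1 : q < 1 := by
      rw [hq, Real.sqrt_lt' one_pos]
      linarith [he.trans_le (min_le_right _ _)]
    set M := √((1 + e) / c) with hM
    have hM0 : 0 ≤ M := Real.sqrt_nonneg _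
    have hMq : 0 ≤ M / (1 - q) := div_nonneg hM0 (sub_pos.2 hq1).le
    -- As the initial distance to `S` is at most `κ * L * dist (y 0) ybar`, `K` collects all terms
    -- of the smallness condition in `cauchySeq_of_local_linear`.
    set K := 1 + (M / (1 - q) + 1) * (κ * L) with hK
    have hK0 : 0 < K := by positivity
    refine ⟨r / K, by positivity, fun y s h0 hd hy hs => ?_⟩
    have hΛ := hmem y h0 hy
    refine hA.exists_tendsto_gap hm0 hPlam hΛ ?_ hs
    have ht : ∀ k, Metric.infDist (y k) S ≤ κ * dist (y k) (y (k + 1)) := fun k => by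
      have h1 := hsub' _ (hΛ k) _ (hy k)
      rwa [hlin, NNReal.coe_mul, coe_nndist] at h1
    refine cauchySeq_of_local_linear (p := ybar) (t := fun k => Metric.infDist (y k) S)
      (fun _ => Metric.infDist_nonneg) (Real.sqrt_nonneg _) hq1 hM0 (r := r) ?_ fun k hk => ?_
    · rw [lt_div_iff₀ hK0] at hd
      have h1 := hA.dist_cyclicDR_le hlam0 hlam1 hm0 h0 (hy 0) hfix hU
      have h2 : Metric.infDist (y 0) S ≤ κ * (L * dist (y 0) ybar) :=
        (ht 0).trans (by gcongr)
      have h3 : (M / (1 - q) + 1) * Metric.infDist (y 0) S ≤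
          (M / (1 - q) + 1) * (κ * (L * dist (y 0) ybar)) := by gcongr
      have h4 : dist (y 0) ybar * K =
          dist (y 0) ybar + (M / (1 - q) + 1) * (κ * (L * dist (y 0) ybar)) := by
        rw [hK]; ring
      linarith
    · have hyk : y k ∈ V := hr (by
        rw [Metric.mem_ball]
        linarith [Metric.infDist_nonneg (x := y k) (s := S)])
      -- The inequality is known only at fixed points in `V`, so points of the closure of `S`
      -- nearest to `y k` must lie there.
      have hball : Metric.closedBall (y k) (Metric.infDist (y k) S) ⊆ V := by
        refine (Metric.closedBall_subset_ball' ?_).trans hr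
        linarith
      have h1 := infDist_sq_le (x' := y (k + 1)) (a := 1 + e) (c := c) (hSne _ h0) hV hball
        fun z hz => by
          have h2 := hT z hz (y k) hyk _ (hy k) z hz.1.1
          rwa [sub_self, sub_zero, ← dist_eq_norm (y (k + 1)) (y k), dist_comm (y (k + 1)),
            ← hc] at h2
      have ht0 : 0 ≤ Metric.infDist (y k) S := Metric.infDist_nonneg
      have h3 : c / κ ^ 2 * Metric.infDist (y k) S ^ 2 ≤ c * dist (y k) (y (k + 1)) ^ 2 := by
        rw [div_mul_eq_mul_div, div_le_iff₀ (by positivity), mul_assoc, mul_comm (_ ^ 2),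
          ← mul_pow]
        gcongr
        exact ht k
      constructor
      · calc Metric.infDist (y (k + 1)) S
            ≤ √((1 + e - c / κ ^ 2) * Metric.infDist (y k) S ^ 2) :=
              Real.le_sqrt_of_sq_le (by linarith)
          _ = √(1 + e - c / κ ^ 2) * Metric.infDist (y k) S := by
              rw [Real.sqrt_mul' _ (sq_nonneg _), Real.sqrt_sq ht0]
      · refine le_of_sq_le_sq ?_ (mul_nonneg hM0 ht0)
        rw [mul_pow, hM, Real.sq_sqrt (by positivity), div_mul_eq_mul_div, le_div_iff₀ hc0]
        linarith [sq_nonneg (Metric.infDist (y (k + 1)) S)]
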